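/- Let $F$ be a real vector lattice with positive cone $F_+$. Recall that $F$ is Archimedean if $\bigwedge_{n\ge 1}\frac1n f=0$ for every $f\in F_+$. An ideal of $F$ is a solid linear subspace; $I(G)$ denotes the intersection of all ideals containing $G\subset F$, an ideal is countably generated if it equals $I(G)$ for some countable $G\subset F$, and $I_e:=I(\{e\})$ for $e\in F_+$. Let $\|\cdot\|_e$ be the Minkowski functional of $[-e,e]$ on $I_e$. $F$ is uniformly complete if for every $e\in F_+$ every $\|\cdot\|_e$-Cauchy sequence in $I_e$ is $\|\cdot\|_e$-convergent in $I_e$. A set $L\subset F$ is uniformly closed if $L\cap I_e$ is $\|\cdot\|_e$-closed in $I_e$ for every $e\in F_+$. A band is an ideal that contains the supremum of any of its subsets whenever that supremum exists in $F$. For $H\subset F$ put $H^d=\{f\in F:\ |f|\wedge|h|=0\text{ for all }h\in H\}$; a projection band is an ideal $H$ with $F=H+H^d$. An element $e\in F_+$ is self-majorizing if for every $f\in F_+$ there is a real $r>0$ such that $f\wedge ne\le re$ for every $n\in\mathbb N$. Assume that $F$ is Archimedean and uniformly complete. Then: 1. For every countably generated ideal $H$ of $F$ the following are equivalent: $H$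 is uniformly closed; $H$ is a band; $H$ is a projection band. 2. For every $e\in F_+$ the following are equivalent: (a) $e$ is self-majorizing; (b) $I_e$ is a projection band; (c) $I_e$ is a band; (d) $I_e$ is uniformly closed. -/

import Mathlib

/-! Throughout, a (real) vector lattice is a real vector space `F` with a lattice order that is
compatible with addition and with multiplication by nonnegative scalars:
`[AddCommGroup F] [Lattice F] [IsOrderedAddMonoid F] [Module ℝ F] [IsOrderedModule ℝ F]`. -/

namespace VectorLattice

section Ideals

variable {F : Type*} [AddCommGroup F] [Lattice F] [Module ℝ F]

/-- An ideal of a vector lattice: a linear subspace which is solid, that is,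
`|f| ≤ |g|` and `g ∈ H` imply `f ∈ H`. -/
def IsIdeal (H : Submodule ℝ F) : Prop :=
  LatticeOrderedAddCommGroup.IsSolid (H : Set F)

/-- The ideal `I(G)` generated by a set `G`: the intersection of all ideals that contain `G`. -/
def idealSpan (G : Set F) : Submodule ℝ F :=
  sInf {J : Submodule ℝ F | IsIdeal J ∧ G ⊆ J}

/-- The principal ideal `I_e`. -/
def principalIdeal (e : F) : Submodule ℝ F :=
  idealSpan {e}

/-- The subspace `H` is an ideal generated by a countable set. -/
def IsCountablyGeneratedIdeal (H : Submodule ℝ F) : Prop :=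
  ∃ G : Set F, G.Countable ∧ H = idealSpan G

/-- A band: an ideal which contains the supremum, whenever it exists in `F`, of any of its
subsets. -/
def IsBand (H : Submodule ℝ F) : Prop :=
  IsIdeal H ∧ ∀ (S : Set F) (f : F), S ⊆ H → IsLUB S f → f ∈ H

/-- The disjoint complement of a set. -/
def disjointCompl (G : Set F) : Set F :=
  {f | ∀ g ∈ G, |f| ⊓ |g| = 0}

/-- A projection band: an ideal `H` such that `F = H + Hᵈ`. -/
def IsProjectionBand (H : Submodule ℝ F) : Prop :=
  IsIdeal H ∧ ∀ f : F, ∃ g ∈ H, ∃ h ∈ disjointCompl (H : Set F), f = g + h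

/-- A positive element `e` is self-majorizing if for every `f ≥ 0` there is `r > 0` with
`f ⊓ n e ≤ r e` for all natural numbers `n`. -/
def IsSelfMajorizing (e : F) : Prop :=
  0 ≤ e ∧ ∀ f : F, 0 ≤ f → ∃ r : ℝ, 0 < r ∧ ∀ n : ℕ, f ⊓ (n : ℝ) • e ≤ r • e

/-- The functional `‖·‖_e`: the Minkowski functional of the order interval `[-e, e]`.
It is used only on `I_e`, where it is finite. -/
noncomputable def unitNorm (e x : F) : ℝ :=
  gauge (Set.Icc (-e) e) x

/-- `L` is uniformly closed: `L ∩ I_e` is `‖·‖_e`-closed in `I_e` for every `e ≥ 0`, that is, each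
point of `I_e` which is a limit of points of `L ∩ I_e` belongs to `L`. -/
def IsUniformlyClosed (L : Set F) : Prop :=
  ∀ e : F, 0 ≤ e → ∀ x ∈ principalIdeal e,
    (∀ ε : ℝ, 0 < ε → ∃ y ∈ L ∩ (principalIdeal e : Set F), unitNorm e (x - y) < ε) → x ∈ L

variable (F)

/-- A vector lattice is Archimedean if `inf_{n ≥ 1} (1/n) f = 0` for every `f ≥ 0`. (This is not
Mathlib's class `Archimedean`, which requires every positive element to be a strong unit.) -/
def IsArchimedean : Prop :=
  ∀ f : F, 0 ≤ f → IsGLB {x : F | ∃ n : ℕ, 1 ≤ n ∧ x = (1 / (n : ℝ)) • f} 0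

/-- A vector lattice is uniformly complete if, for every `e ≥ 0`, the ideal `I_e` is complete
with respect to `‖·‖_e`: every `‖·‖_e`-Cauchy sequence in `I_e` converges in `I_e`. -/
def IsUniformlyComplete : Prop :=
  ∀ e : F, 0 ≤ e → ∀ u : ℕ → F, (∀ n, u n ∈ principalIdeal e) →
    (∀ ε : ℝ, 0 < ε → ∃ N : ℕ, ∀ m ≥ N, ∀ n ≥ N, unitNorm e (u m - u n) < ε) →
    ∃ x ∈ principalIdeal e, ∀ ε : ℝ, 0 < ε → ∃ N : ℕ, ∀ n ≥ N, unitNorm e (u n - x) < ε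

end Ideals

end VectorLattice

/-! The equivalences rest on one splitting principle. If `f, g ≥ 0` and `f ⊓ (r + 1) g ≤ r g` for
some `r ≥ 0`, then `f - f ⊓ r g` is disjoint from `g`
(`VectorLattice.sub_inf_smul_inf_eq_zero`): in a function
lattice, the hypothesis says that `f ≤ r g` wherever `g` is positive.

For a self-majorizing `e` the hypothesis holds by definition, with `g = e`. For a uniformly closed
ideal `H` with a cofinal sequence `e₀, e₁, …` of positive elements, it is obtained as follows.
Given `f ≥ 0`, uniform completeness lets one sum `∑ 2⁻ᵏ (f ⊓ eₖ)`; the sum lies in `H` since `H` is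
uniformly closed, which gives `g ∈ H` such that a positive element below `f` that is disjoint from
`g` is disjoint from `H`. Applying the same summation to `f ⊓ 4ᵏ g` gives `y ∈ H` with
`f ⊓ 4ᵏ g ≤ 2ᵏ y` and `y ≤ f ⊓ eₘ ≤ 2ᵐ g` for some `m`. Hence `f ⊓ 4ᵏ g ≤ 2ᵏ⁺ᵐ g` for all `k`, and
`k = m + 1` makes `4ᵏ` larger than `2ᵏ⁺ᵐ`. In a space `C(K)` this `y` plays the role of the square
root of `g`: that `√g` is dominated by `g` keeps `g` away from zero on its support.

The remaining implications are general. A projection band is a band because both components of a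
nonnegative element of `H + Hᵈ` are nonnegative. A band `H` is uniformly closed because
`|x| = sup (|x| - e / n)⁺` in an Archimedean vector lattice, and `(|x| - e / n)⁺ ≤ |y|` as soon as
`|x - y| ≤ e / n`. -/

namespace VectorLattice

variable {F : Type*} [AddCommGroup F] [Lattice F] [IsOrderedAddMonoid F]
    [Module ℝ F] [IsOrderedModule ℝ F]

set_option linter.unusedSectionVars false

/-! ### Absolute values and disjointness -/

theorem abs_smul_le (c : ℝ) (x : F) : |c • x| ≤ |c| • |x| := by
  rcases le_total 0 c with hc | hc
  · rw [abs_of_nonneg hc]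
    refine abs_le'.2 ⟨smul_le_smul_of_nonneg_left (le_abs_self x) hc, ?_⟩
    rw [← smul_neg]
    exact smul_le_smul_of_nonneg_left (neg_le_abs x) hc
  · rw [abs_of_nonpos hc]
    have hc' : 0 ≤ -c := neg_nonneg.2 hc
    refine abs_le'.2 ⟨?_, ?_⟩
    · rw [← neg_smul_neg]
      exact smul_le_smul_of_nonneg_left (neg_le_abs x) hc'
    · rw [← neg_smul]
      exact smul_le_smul_of_nonneg_left (le_abs_self x) hc'

theorem smul_le_smul_of_le_of_nonneg {r s : ℝ} {e : F} (he : 0 ≤ e) (h : r ≤ s) :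
    r • e ≤ s • e :=
  smul_le_smul_of_nonneg_right h he

theorem inf_smul_eq_zero {x y : F} (hx : 0 ≤ x) (hy : 0 ≤ y) (h : x ⊓ y = 0) {c : ℝ}
    (hc : 0 ≤ c) : x ⊓ c • y = 0 := by
  refine le_antisymm ?_ (le_inf hx (smul_nonneg hc hy))
  have hd : (0 : ℝ) < c + 1 := by linarith
  have hz : 0 ≤ x ⊓ c • y := le_inf hx (smul_nonneg hc hy)
  have h1 : (c + 1)⁻¹ • (x ⊓ c • y) ≤ x ⊓ y := by
    refine le_inf ?_ ?_
    · calc (c + 1)⁻¹ • (x ⊓ c • y) ≤ (1 : ℝ) • (x ⊓ c • y) :=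
            smul_le_smul_of_le_of_nonneg hz (inv_le_one_of_one_le₀ (by linarith))
        _ ≤ x := by rw [one_smul]; exact inf_le_left
    · rw [inv_smul_le_iff_of_pos hd]
      exact inf_le_right.trans (smul_le_smul_of_le_of_nonneg hy (by linarith))
  rw [h, inv_smul_le_iff_of_pos hd, smul_zero] at h1
  exact h1

theorem add_inf_eq_zero {a b c : F} (ha : 0 ≤ a) (hb : 0 ≤ b) (hc : 0 ≤ c) (hac : a ⊓ c = 0)
    (hbc : b ⊓ c = 0) : (a + b) ⊓ c = 0 := by
  refine le_antisymm ?_ (le_inf (add_nonneg ha hb) hc)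
  have h1 : (a + b) ⊓ c - b ≤ a ⊓ c :=
    le_inf (sub_le_iff_le_add.2 inf_le_left) ((sub_le_self _ hb).trans inf_le_right)
  rw [hac, sub_nonpos] at h1
  exact (le_inf h1 inf_le_right).trans hbc.le

theorem nonneg_of_add_nonneg_of_disjoint {a h : F} (hd : |a| ⊓ |h| = 0) (hs : 0 ≤ a + h) :
    0 ≤ h := by
  have h1 : -h ≤ |a| ⊓ |h| :=
    le_inf ((neg_le_iff_add_nonneg.2 hs).trans (le_abs_self a)) (neg_le_abs h)
  rwa [hd, neg_nonpos] at h1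

theorem sub_mem_disjointCompl {G : Set F} {a b : F} (ha : a ∈ disjointCompl G)
    (hb : b ∈ disjointCompl G) : a - b ∈ disjointCompl G := by
  intro g hg
  refine le_antisymm ?_ (le_inf (abs_nonneg _) (abs_nonneg _))
  refine (inf_le_inf_right |g| ?_).trans
    (add_inf_eq_zero (abs_nonneg a) (abs_nonneg b) (abs_nonneg g) (ha g hg) (hb g hg)).le
  have := abs_add_le a (-b)
  rwa [abs_neg, ← sub_eq_add_neg] at this

/-- In a function lattice, the hypothesis says that `f ≤ r g` wherever `g > 0`, so that
the part of `f` above `r g` lives where `g` vanishes. -/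
theorem sub_inf_smul_inf_eq_zero {f g : F} (hg : 0 ≤ g) {r : ℝ}
    (h : f ⊓ (r + 1) • g ≤ r • g) : (f - f ⊓ r • g) ⊓ g = 0 := by
  set z := (f - f ⊓ r • g) ⊓ g with hz
  refine le_antisymm ?_ (le_inf (sub_nonneg.2 inf_le_left) hg)
  have h1 : z + f ⊓ r • g ≤ f := le_sub_iff_add_le.1 inf_le_left
  have h2 : z + f ⊓ r • g ≤ (r + 1) • g := by
    rw [add_smul, one_smul, add_comm (r • g)]
    exact add_le_add inf_le_right inf_le_right
  have h3 : z + f ⊓ r • g ≤ f ⊓ r • g := le_inf h1 ((le_inf h1 h2).trans h)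
  exact add_le_iff_nonpos_left.1 h3

/-- The Archimedean property in the form in which it is used. -/
theorem IsArchimedean.nonpos (hA : IsArchimedean F) {x e : F} (he : 0 ≤ e)
    (h : ∀ ε : ℝ, 0 < ε → x ≤ ε • e) : x ≤ 0 := by
  refine (hA e he).2 ?_
  rintro _ ⟨n, hn, rfl⟩
  exact h _ (by positivity)

/-! ### Ideals -/

theorem isIdeal_idealSpan (G : Set F) : IsIdeal (idealSpan G) := by
  intro x hx y hxy
  simp only [idealSpan, SetLike.mem_coe, Submodule.mem_sInf] at hx ⊢
  exact fun J hJ => hJ.1 (hx J hJ) hxy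

theorem subset_idealSpan (G : Set F) : G ⊆ idealSpan G := by
  intro x hx
  simp only [idealSpan, SetLike.mem_coe, Submodule.mem_sInf]
  exact fun J hJ => hJ.2 hx

theorem idealSpan_le {G : Set F} {J : Submodule ℝ F} (hJ : IsIdeal J) (hG : G ⊆ J) :
    idealSpan G ≤ J :=
  sInf_le ⟨hJ, hG⟩

theorem IsIdeal.abs_mem {H : Submodule ℝ F} (hH : IsIdeal H) {x : F} (hx : x ∈ H) : |x| ∈ H :=
  hH hx (abs_abs x).le

theorem IsIdeal.mem_of_nonneg_of_le {H : Submodule ℝ F} (hH : IsIdeal H) {x y : F} (hx : x ∈ H)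
    (hy : 0 ≤ y) (hyx : y ≤ x) : y ∈ H :=
  hH hx (abs_le_abs_of_nonneg hy hyx)

/-- The sequence `n ∑_{i < n} |uᵢ|`, which is cofinal in the ideal generated by the `uᵢ`. -/
def cofinalSeq (u : ℕ → F) (n : ℕ) : F :=
  (n : ℝ) • ∑ i ∈ Finset.range n, |u i|

theorem cofinalSeq_nonneg (u : ℕ → F) (n : ℕ) : 0 ≤ cofinalSeq u n :=
  smul_nonneg n.cast_nonneg (Finset.sum_nonneg fun i _ => abs_nonneg (u i))

theorem smul_cofinalSeq_le (u : ℕ → F) {k n m : ℕ} (hnm : n ≤ m) (h : k * n ≤ m) :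
    (k : ℝ) • cofinalSeq u n ≤ cofinalSeq u m := by
  unfold cofinalSeq
  rw [smul_smul]
  have h1 : ((k : ℝ) * n) ≤ m := by exact_mod_cast h
  exact (smul_le_smul_of_le_of_nonneg (Finset.sum_nonneg fun i _ => abs_nonneg (u i)) h1).trans
    (smul_le_smul_of_nonneg_left
      (Finset.sum_le_sum_of_subset_of_nonneg (Finset.range_mono hnm) fun i _ _ => abs_nonneg (u i))
      m.cast_nonneg)

theorem cofinalSeq_mono (u : ℕ → F) : Monotone (cofinalSeq u) := fun n m hnm => by
  simpa using smul_cofinalSeq_le u (k := 1) hnm (by simpa using hnm)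

/-- The ideal generated by a sequence `u`, described through `cofinalSeq u`. -/
def seqIdeal (u : ℕ → F) : Submodule ℝ F where
  carrier := {x | ∃ n, |x| ≤ cofinalSeq u n}
  zero_mem' := ⟨0, by simp [cofinalSeq]⟩
  add_mem' := by
    rintro x y ⟨n, hn⟩ ⟨m, hm⟩
    refine ⟨2 * max n m, (abs_add_le x y).trans ?_⟩
    refine le_trans ?_ (smul_cofinalSeq_le u (k := 2) (n := max n m) (by omega) le_rfl)
    rw [Nat.cast_two, two_smul]
    exact add_le_add (hn.trans (cofinalSeq_mono u (le_max_left n m)))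
      (hm.trans (cofinalSeq_mono u (le_max_right n m)))
  smul_mem' := by
    rintro c x ⟨n, hn⟩
    obtain ⟨k, hk⟩ := exists_nat_ge |c|
    refine ⟨max n (k * n), (abs_smul_le c x).trans ?_⟩
    exact (smul_le_smul_of_le_of_nonneg (abs_nonneg x) hk).trans
      ((smul_le_smul_of_nonneg_left hn k.cast_nonneg).trans
        (smul_cofinalSeq_le u (le_max_left _ _) (le_max_right _ _)))

theorem idealSpan_range (u : ℕ → F) : idealSpan (Set.range u) = seqIdeal u := by
  apply le_antisymm
  · refine idealSpan_le (fun x ⟨n, hn⟩ y hyx => ⟨n, hyx.trans hn⟩) ?_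
    rintro _ ⟨i, rfl⟩
    refine ⟨i + 1, ?_⟩
    have h0 : 0 ≤ ∑ j ∈ Finset.range (i + 1), |u j| :=
      Finset.sum_nonneg fun j _ => abs_nonneg (u j)
    calc |u i| ≤ ∑ j ∈ Finset.range (i + 1), |u j| :=
          Finset.single_le_sum (f := fun j => |u j|) (fun j _ => abs_nonneg (u j))
            (Finset.self_mem_range_succ i)
      _ = (1 : ℝ) • ∑ j ∈ Finset.range (i + 1), |u j| := (one_smul _ _).symm
      _ ≤ cofinalSeq u (i + 1) := smul_le_smul_of_le_of_nonneg h0 (by simp)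
  · rintro x ⟨n, hn⟩
    have hI := isIdeal_idealSpan (Set.range u)
    refine hI (x := cofinalSeq u n) ?_ (by rwa [abs_of_nonneg (cofinalSeq_nonneg u n)])
    exact Submodule.smul_mem _ _
      (Submodule.sum_mem _ fun i _ => hI.abs_mem (subset_idealSpan _ ⟨i, rfl⟩))

theorem self_mem_principalIdeal (e : F) : e ∈ principalIdeal e :=
  subset_idealSpan _ rfl

theorem isIdeal_principalIdeal (e : F) : IsIdeal (principalIdeal e) :=
  isIdeal_idealSpan _

theorem mem_principalIdeal {e x : F} (he : 0 ≤ e) :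
    x ∈ principalIdeal e ↔ ∃ r : ℝ, 0 < r ∧ |x| ≤ r • e := by
  constructor
  · intro hx
    have hr : ({e} : Set F) = Set.range fun _ : ℕ => e := Set.range_const.symm
    rw [principalIdeal, hr, idealSpan_range] at hx
    obtain ⟨n, hn⟩ := hx
    refine ⟨(n : ℝ) * n + 1, by positivity, hn.trans ?_⟩
    rw [cofinalSeq, Finset.sum_const, Finset.card_range, abs_of_nonneg he,
      ← Nat.cast_smul_eq_nsmul ℝ, smul_smul]
    exact smul_le_smul_of_le_of_nonneg he (by linarith)
  · rintro ⟨r, hr, hx⟩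
    refine isIdeal_principalIdeal e (x := r • e)
      (Submodule.smul_mem _ _ (self_mem_principalIdeal e)) ?_
    rwa [abs_of_nonneg (smul_nonneg hr.le he)]

theorem isCountablyGeneratedIdeal_principalIdeal (e : F) :
    IsCountablyGeneratedIdeal (principalIdeal e) :=
  ⟨{e}, Set.countable_singleton e, rfl⟩

theorem IsCountablyGeneratedIdeal.isIdeal {H : Submodule ℝ F} (hH : IsCountablyGeneratedIdeal H) :
    IsIdeal H := by
  obtain ⟨G, -, rfl⟩ := hH
  exact isIdeal_idealSpan G

theorem IsCountablyGeneratedIdeal.exists_cofinal {H : Submodule ℝ F}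
    (hH : IsCountablyGeneratedIdeal H) :
    ∃ e : ℕ → F, (∀ n, 0 ≤ e n ∧ e n ∈ H) ∧ ∀ x ∈ H, ∃ n, |x| ≤ e n := by
  obtain ⟨G, hG, rfl⟩ := hH
  -- Adding `0` to the generators makes them the range of a sequence also when `G` is empty.
  obtain ⟨u, hu⟩ := (hG.insert 0).exists_eq_range (Set.insert_nonempty 0 G)
  have hGu : idealSpan G = seqIdeal u := by
    rw [← idealSpan_range, ← hu]
    apply le_antisymm
    · exact idealSpan_le (isIdeal_idealSpan _) ((Set.subset_insert 0 G).trans (subset_idealSpan _))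
    · exact idealSpan_le (isIdeal_idealSpan _)
        (Set.insert_subset (Submodule.zero_mem _) (subset_idealSpan G))
  rw [hGu]
  exact ⟨cofinalSeq u, fun n => ⟨cofinalSeq_nonneg u n,
    n, (abs_of_nonneg (cofinalSeq_nonneg u n)).le⟩, fun x hx => hx⟩

/-! ### The norm of a principal ideal -/

open scoped Pointwise in
theorem mem_smul_Icc {e x : F} {r : ℝ} (hr : 0 < r) :
    x ∈ r • Set.Icc (-e) e ↔ |x| ≤ r • e := by
  rw [Set.mem_smul_set_iff_inv_smul_mem₀ hr.ne', Set.mem_Icc, inv_smul_le_iff_of_pos hr,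
    le_inv_smul_iff_of_pos hr, smul_neg, abs_le', neg_le, and_comm]

theorem unitNorm_le {e x : F} {r : ℝ} (hr : 0 < r) (h : |x| ≤ r • e) : unitNorm e x ≤ r :=
  gauge_le_of_mem hr.le ((mem_smul_Icc hr).2 h)

/-- Membership of `x` in `I_e` is needed: outside `I_e` the functional takes the value `0`. -/
theorem abs_le_of_unitNorm_lt {e x : F} (he : 0 ≤ e) (hx : x ∈ principalIdeal e) {r : ℝ}
    (h : unitNorm e x < r) : |x| ≤ r • e := by
  obtain ⟨s, hs, hxs⟩ := (mem_principalIdeal he).1 hx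
  rw [unitNorm, gauge_def] at h
  obtain ⟨t, ⟨ht, hxt⟩, htr⟩ := exists_lt_of_csInf_lt
    (by exact ⟨s, hs, (mem_smul_Icc hs).2 hxs⟩) h
  exact ((mem_smul_Icc ht).1 hxt).trans (smul_le_smul_of_le_of_nonneg he htr.le)

/-! ### Projection bands, bands and uniformly closed ideals -/

theorem IsProjectionBand.isBand {H : Submodule ℝ F} (hH : IsProjectionBand H) : IsBand H := by
  refine ⟨hH.1, fun S f hS hf => ?_⟩
  obtain ⟨g, hg, h, hh, rfl⟩ := hH.2 f
  have key : ∀ s ∈ S, s ≤ g ∧ 0 ≤ h := by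
    intro s hs
    have h1 : 0 ≤ (g - s) + h := by
      rw [sub_add_eq_add_sub]
      exact sub_nonneg.2 (hf.1 hs)
    have hd : |h| ⊓ |g - s| = 0 := hh _ (H.sub_mem hg (hS hs))
    refine ⟨sub_nonneg.1 (nonneg_of_add_nonneg_of_disjoint hd ?_),
      nonneg_of_add_nonneg_of_disjoint (inf_comm |h| _ ▸ hd) h1⟩
    rwa [add_comm]
  have hle : h ≤ 0 := by simpa using hf.2 fun s hs => (key s hs).1
  rcases S.eq_empty_or_nonempty with rfl | ⟨s, hs⟩
  · -- The empty set has a supremum only if `F` has a least element, that is, if `F` is zero.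
    have hbot : ∀ x, g + h ≤ x := fun x => hf.2 fun s hs => hs.elim
    have h0 : g + h = 0 := le_antisymm (hbot 0) (by simpa using hbot ((g + h) + (g + h)))
    rw [h0]
    exact H.zero_mem
  · rw [le_antisymm hle (key s hs).2, add_zero]
    exact hg

theorem IsBand.isUniformlyClosed (hA : IsArchimedean F) {H : Submodule ℝ F} (hH : IsBand H) :
    IsUniformlyClosed (H : Set F) := by
  intro e he x hx happ
  have hlub : IsLUB {z | ∃ ε : ℝ, 0 < ε ∧ z = (|x| - ε • e) ⊔ 0} |x| := by
    constructor
    · rintro _ ⟨ε, hε, rfl⟩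
      exact sup_le (sub_le_self _ (smul_nonneg hε.le he)) (abs_nonneg x)
    · intro b hb
      refine sub_nonpos.1 (hA.nonpos he fun ε hε => ?_)
      exact sub_le_comm.1 (le_sup_left.trans (hb ⟨ε, hε, rfl⟩))
  refine hH.1 (hH.2 _ _ ?_ hlub) (abs_abs x).ge
  rintro _ ⟨ε, hε, rfl⟩
  obtain ⟨y, ⟨hyH, hye⟩, hy⟩ := happ ε hε
  refine hH.1.mem_of_nonneg_of_le (hH.1.abs_mem hyH) le_sup_right
    (sup_le (sub_le_iff_le_add.2 ?_) (abs_nonneg y))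
  calc |x| = |y + (x - y)| := by rw [add_sub_cancel]
    _ ≤ |y| + |x - y| := abs_add_le _ _
    _ ≤ |y| + ε • e := by
        gcongr
        exact abs_le_of_unitNorm_lt he (Submodule.sub_mem _ hx hye) hy

/-- It suffices to decompose positive elements. -/
theorem isProjectionBand_of_nonneg {H : Submodule ℝ F} (hH : IsIdeal H)
    (h : ∀ f : F, 0 ≤ f → ∃ g ∈ H, f - g ∈ disjointCompl (H : Set F)) : IsProjectionBand H := by
  refine ⟨hH, fun f => ?_⟩
  obtain ⟨g₁, hg₁, hd₁⟩ := h f⁺ (posPart_nonneg f)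
  obtain ⟨g₂, hg₂, hd₂⟩ := h f⁻ (negPart_nonneg f)
  refine ⟨g₁ - g₂, H.sub_mem hg₁ hg₂, _, sub_mem_disjointCompl hd₁ hd₂, ?_⟩
  conv_lhs => rw [← posPart_sub_negPart f]
  abel

/-- Summation of `∑ 2⁻ᵏ vₖ` inside a uniformly closed ideal: the sum dominates each of its
terms. -/
theorem IsUniformlyClosed.exists_dominating (hA : IsArchimedean F) (hC : IsUniformlyComplete F)
    {H : Submodule ℝ F} (hH : IsIdeal H) (hcl : IsUniformlyClosed (H : Set F)) {f : F}
    (hf : 0 ≤ f) {v : ℕ → F} (hvH : ∀ k, v k ∈ H) (hv0 : ∀ k, 0 ≤ v k) (hvf : ∀ k, v k ≤ f) :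
    ∃ x ∈ H, 0 ≤ x ∧ x ≤ f ∧ ∀ k, (1 / 2 : ℝ) ^ k • v k ≤ x := by
  set u : ℕ → F := fun n => ∑ k ∈ Finset.range n, (1 / 2 : ℝ) ^ k • v k with hu
  have hterm : ∀ k, 0 ≤ (1 / 2 : ℝ) ^ k • v k := fun k => smul_nonneg (by positivity) (hv0 k)
  have hmono : Monotone u := monotone_nat_of_le_succ fun n => by
    simp only [hu, Finset.sum_range_succ]
    exact le_add_of_nonneg_right (hterm n)
  have htail : ∀ m n, m ≤ n → u n ≤ u m + (2 * (1 / 2) ^ m - 2 * (1 / 2) ^ n : ℝ) • f := by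
    intro m n hmn
    induction n, hmn using Nat.le_induction with
    | base => simp
    | succ n hmn ih =>
      calc u (n + 1) = u n + (1 / 2 : ℝ) ^ n • v n := Finset.sum_range_succ _ _
        _ ≤ (u m + (2 * (1 / 2) ^ m - 2 * (1 / 2) ^ n : ℝ) • f) + (1 / 2 : ℝ) ^ n • f :=
            add_le_add ih (smul_le_smul_of_nonneg_left (hvf n) (by positivity))
        _ = u m + (2 * (1 / 2) ^ m - 2 * (1 / 2) ^ (n + 1) : ℝ) • f := by
            rw [add_assoc, ← add_smul]
            congr 2
            ring
  have huf : ∀ n, u n ∈ principalIdeal f := fun n => Submodule.sum_mem _ fun k _ =>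
    Submodule.smul_mem _ _ ((isIdeal_principalIdeal f).mem_of_nonneg_of_le
      (self_mem_principalIdeal f) (hv0 k) (hvf k))
  have huH : ∀ n, u n ∈ H := fun n =>
    Submodule.sum_mem _ fun k _ => Submodule.smul_mem _ _ (hvH k)
  have hdist : ∀ N m n, N ≤ m → N ≤ n → u m - u n ≤ (2 * (1 / 2) ^ N : ℝ) • f := by
    intro N m n hm hn
    rw [sub_le_iff_le_add']
    refine (htail N m hm).trans (add_le_add (hmono hn) (smul_le_smul_of_le_of_nonneg hf ?_))
    have : (0 : ℝ) < (1 / 2) ^ m := by positivity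
    linarith
  obtain ⟨x, hxf, hx⟩ := hC f hf u huf fun ε hε => by
    obtain ⟨N, hN⟩ := exists_pow_lt_of_lt_one (half_pos hε) (by norm_num : (1 / 2 : ℝ) < 1)
    refine ⟨N, fun m hm n hn => (unitNorm_le (by positivity)
      (abs_le'.2 ⟨hdist N m n hm hn, ?_⟩)).trans_lt (by linarith : 2 * (1 / 2 : ℝ) ^ N < ε)⟩
    rw [neg_sub]
    exact hdist N n m hn hm
  have hclose : ∀ ε : ℝ, 0 < ε → ∃ N, ∀ n ≥ N, |u n - x| ≤ ε • f := fun ε hε => by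
    obtain ⟨N, hN⟩ := hx ε hε
    exact ⟨N, fun n hn => abs_le_of_unitNorm_lt hf (Submodule.sub_mem _ (huf n) hxf) (hN n hn)⟩
  have hxH : x ∈ H := by
    refine hcl f hf x hxf fun ε hε => ?_
    obtain ⟨N, hN⟩ := hclose (ε / 2) (half_pos hε)
    refine ⟨u N, ⟨huH N, huf N⟩, (unitNorm_le (half_pos hε) ?_).trans_lt (half_lt_self hε)⟩
    rw [abs_sub_comm]
    exact hN N le_rfl
  have hdom : ∀ k, (1 / 2 : ℝ) ^ k • v k ≤ x := fun k => by
    refine sub_nonpos.1 (hA.nonpos hf fun ε hε => ?_)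
    obtain ⟨N, hN⟩ := hclose ε hε
    refine le_trans ?_ ((le_abs_self _).trans (hN (max N (k + 1)) (le_max_left _ _)))
    refine sub_le_sub_right (le_trans ?_ (hmono (le_max_right N (k + 1)))) x
    exact Finset.single_le_sum (f := fun k => (1 / 2 : ℝ) ^ k • v k) (fun j _ => hterm j)
      (Finset.self_mem_range_succ k)
  have hx0 : 0 ≤ x := (hterm 0).trans (hdom 0)
  -- Each `2⁻ᵏ vₖ` is below `f` as well, so the sum may be cut off at `f`.
  refine ⟨x ⊓ f, hH.mem_of_nonneg_of_le hxH (le_inf hx0 hf) inf_le_left, le_inf hx0 hf,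
    inf_le_right, fun k => le_inf (hdom k) ?_⟩
  calc (1 / 2 : ℝ) ^ k • v k ≤ (1 : ℝ) • v k :=
        smul_le_smul_of_le_of_nonneg (hv0 k) (pow_le_one₀ (by norm_num) (by norm_num))
    _ ≤ f := by rw [one_smul]; exact hvf k

theorem le_two_pow_smul {k : ℕ} {x y : F} (h : (1 / 2 : ℝ) ^ k • x ≤ y) : x ≤ (2 : ℝ) ^ k • y := by
  rwa [one_div, inv_pow, inv_smul_le_iff_of_pos (by positivity)] at h

theorem IsUniformlyClosed.isProjectionBand (hA : IsArchimedean F) (hC : IsUniformlyComplete F)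
    {H : Submodule ℝ F} (hcg : IsCountablyGeneratedIdeal H)
    (hcl : IsUniformlyClosed (H : Set F)) : IsProjectionBand H := by
  have hH := hcg.isIdeal
  obtain ⟨e, he, hcof⟩ := hcg.exists_cofinal
  refine isProjectionBand_of_nonneg hH fun f hf => ?_
  obtain ⟨g, hgH, hg0, -, hg⟩ := hcl.exists_dominating hA hC hH hf (v := fun k => f ⊓ e k)
    (fun k => hH.mem_of_nonneg_of_le (he k).2 (le_inf hf (he k).1) inf_le_right)
    (fun k => le_inf hf (he k).1) (fun k => inf_le_left)
  have hpow : ∀ k : ℕ, 0 ≤ (4 : ℝ) ^ k • g := fun k => smul_nonneg (by positivity) hg0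
  obtain ⟨y, hyH, hy0, hyf, hy⟩ :=
    hcl.exists_dominating hA hC hH hf (v := fun k => f ⊓ (4 : ℝ) ^ k • g)
      (fun k => hH.mem_of_nonneg_of_le (H.smul_mem _ hgH) (le_inf hf (hpow k)) inf_le_right)
      (fun k => le_inf hf (hpow k)) (fun k => inf_le_left)
  obtain ⟨m, hm⟩ := hcof y hyH
  have hyg : y ≤ (2 : ℝ) ^ m • g :=
    (le_inf hyf ((le_abs_self y).trans hm)).trans (le_two_pow_smul (hg m))
  set r : ℝ := 2 ^ (m + 1) * 2 ^ m with hr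
  have hr0 : 0 ≤ r := by positivity
  have hr4 : r + 1 ≤ 4 ^ (m + 1) := by
    have h4 : (4 : ℝ) ^ (m + 1) = 2 * r := by
      rw [hr, show (4 : ℝ) = 2 * 2 by norm_num, mul_pow]
      ring
    have h1 : 1 ≤ r := one_le_mul_of_one_le_of_one_le (one_le_pow₀ one_le_two)
      (one_le_pow₀ one_le_two)
    linarith
  have hsplit : f ⊓ (r + 1) • g ≤ r • g := by
    calc f ⊓ (r + 1) • g ≤ f ⊓ (4 : ℝ) ^ (m + 1) • g :=
          inf_le_inf_left f (smul_le_smul_of_le_of_nonneg hg0 hr4)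
      _ ≤ (2 : ℝ) ^ (m + 1) • y := le_two_pow_smul (hy (m + 1))
      _ ≤ (2 : ℝ) ^ (m + 1) • (2 : ℝ) ^ m • g :=
          smul_le_smul_of_nonneg_left hyg (by positivity)
      _ = r • g := smul_smul _ _ _
  have hrg : 0 ≤ f ⊓ r • g := le_inf hf (smul_nonneg hr0 hg0)
  refine ⟨f ⊓ r • g, hH.mem_of_nonneg_of_le (H.smul_mem r hgH) hrg inf_le_right, fun h hh => ?_⟩
  have hw0 : 0 ≤ f - f ⊓ r • g := sub_nonneg.2 inf_le_left
  refine le_antisymm ?_ (le_inf (abs_nonneg _) (abs_nonneg _))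
  obtain ⟨n, hn⟩ := hcof h hh
  rw [abs_of_nonneg hw0]
  refine le_trans (le_inf inf_le_left ?_) (inf_smul_eq_zero hw0 hg0
    (sub_inf_smul_inf_eq_zero hg0 hsplit) (by positivity : (0 : ℝ) ≤ 2 ^ n)).le
  exact (inf_le_inf (sub_le_self f hrg) hn).trans (le_two_pow_smul (hg n))

/-! ### Self-majorizing elements -/

theorem IsSelfMajorizing.isProjectionBand {e : F} (h : IsSelfMajorizing e) :
    IsProjectionBand (principalIdeal e) := by
  have he := h.1
  have hI := isIdeal_principalIdeal e
  refine isProjectionBand_of_nonneg hI fun f hf => ?_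
  obtain ⟨r, hr, hfr⟩ := h.2 f hf
  obtain ⟨n, hn⟩ := exists_nat_ge (r + 1)
  have hd := sub_inf_smul_inf_eq_zero he
    ((inf_le_inf_left f (smul_le_smul_of_le_of_nonneg he hn)).trans (hfr n))
  have hw0 : 0 ≤ f - f ⊓ r • e := sub_nonneg.2 inf_le_left
  refine ⟨f ⊓ r • e, hI.mem_of_nonneg_of_le (Submodule.smul_mem _ r (self_mem_principalIdeal e))
    (le_inf hf (smul_nonneg hr.le he)) inf_le_right, fun x hx => ?_⟩
  obtain ⟨s, hs, hxs⟩ := (mem_principalIdeal he).1 hx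
  refine le_antisymm ?_ (le_inf (abs_nonneg _) (abs_nonneg _))
  rw [abs_of_nonneg hw0]
  exact (inf_le_inf_left _ hxs).trans (inf_smul_eq_zero hw0 he hd hs.le).le

theorem IsProjectionBand.isSelfMajorizing {e : F} (he : 0 ≤ e)
    (h : IsProjectionBand (principalIdeal e)) : IsSelfMajorizing e := by
  refine ⟨he, fun f _ => ?_⟩
  obtain ⟨g, hg, d, hd, rfl⟩ := h.2 f
  obtain ⟨r, hr, hgr⟩ := (mem_principalIdeal he).1 hg
  refine ⟨r, hr, fun n => le_trans ?_ hgr⟩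
  have hne : 0 ≤ (n : ℝ) • e := smul_nonneg n.cast_nonneg he
  have hdn : |d| ⊓ |(n : ℝ) • e| = 0 :=
    hd _ (Submodule.smul_mem _ _ (self_mem_principalIdeal e))
  rw [abs_of_nonneg hne] at hdn
  rw [← sub_nonpos, ← hdn]
  refine le_inf (sub_le_iff_le_add'.2 ?_) ((sub_le_self _ (abs_nonneg g)).trans inf_le_right)
  exact inf_le_left.trans (add_le_add (le_abs_self g) (le_abs_self d))

end VectorLattice

theorem corollary3p19 {F : Type*} [AddCommGroup F] [Lattice F] [IsOrderedAddMonoid F]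
    [Module ℝ F] [IsOrderedModule ℝ F]
    (hA : VectorLattice.IsArchimedean F) (hC : VectorLattice.IsUniformlyComplete F) :
    (∀ H : Submodule ℝ F, VectorLattice.IsCountablyGeneratedIdeal H →
      (VectorLattice.IsUniformlyClosed (H : Set F) ↔ VectorLattice.IsBand H) ∧
      (VectorLattice.IsBand H ↔ VectorLattice.IsProjectionBand H)) ∧
    (∀ e : F, 0 ≤ e →
      List.TFAE [
        VectorLattice.IsSelfMajorizing e,
        VectorLattice.IsProjectionBand (VectorLattice.principalIdeal e),
        VectorLattice.IsBand (VectorLattice.principalIdeal e),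
        VectorLattice.IsUniformlyClosed (VectorLattice.principalIdeal e : Set F)]) := by
  refine ⟨fun H hH => ?_, fun e he => ?_⟩
  · exact ⟨⟨fun h => (h.isProjectionBand hA hC hH).isBand, fun h => h.isUniformlyClosed hA⟩,
      fun h => (h.isUniformlyClosed hA).isProjectionBand hA hC hH, fun h => h.isBand⟩
  · tfae_have 1 → 2 := fun h => h.isProjectionBand
    tfae_have 2 → 1 := fun h => h.isSelfMajorizing he
    tfae_have 2 → 3 := fun h => h.isBand
    tfae_have 3 → 4 := fun h => h.isUniformlyClosed hA
    tfae_have 4 → 2 := fun h => h.isProjectionBand hA hC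
      (VectorLattice.isCountablyGeneratedIdeal_principalIdeal e)
    tfae_finish
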